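/- Let $\nu\ge 3$. Write $|n|=|n_1|+\dots+|n_\nu|$ for $n\in\mathbb Z^\nu$, let $H_0$ be the bounded self-adjoint operator on the complex Hilbert space $\ell^2(\mathbb Z^\nu)$ given by $(H_0u)(n)=\sum_{|j|=1}u(n+j)$, and let a bounded function $V:\mathbb Z^\nu\to\mathbb R$ act on $\ell^2(\mathbb Z^\nu)$ by multiplication, $(Vu)(n)=V(n)u(n)$. Then there exists a bounded potential $V:\mathbb Z^\nu\to\mathbb R$ such that $$\sigma(H_0+V)=[-2\nu,2\nu]\qquad\text{and}\qquad \limsup_{|n|\to\infty}|V(n)|>0 .$$ Moreover, $V$ can be chosen to be nonnegative and sparse, in the sense that for every $R$ there are only finitely many pairs of distinct points $n,m$ with $V(n)\ne0$, $V(m)\neq 0$ and $|n-m|\le R$. Consequently, for every $\nu\ge3$, it is not true that every bounded $V:\mathbb Z^\nu\to\mathbb R$ with $\sigma_{\rm ess}(H_0+V)\subset[-2\nu,2\nu]$ satisfies $V(n)\to0$ as $|n|\to\infty$ (here $\sigma_{\rm ess}$ is the spectrum with the isolated eigenvalues of finite multiplicity removed). -/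

import Mathlib

open Filter Topology
open scoped ENNReal

namespace DiscreteSchrodinger

/-- The lattice `ℤ^ν`. -/
abbrev Lattice (ν : ℕ) : Type := Fin ν → ℤ

/-- The length `|n| = |n₁| + ⋯ + |n_ν|` of a lattice point. -/
def len {ν : ℕ} (n : Lattice ν) : ℤ := ∑ i, |n i|

/-- The complex Hilbert space `ℓ²(ℤ^ν)`. -/
abbrev Hilb (ν : ℕ) : Type := lp (fun _ : Lattice ν => ℂ) 2

/-- Bounded real potentials: the space `ℓ^∞(ℤ^ν)` of real functions. -/
abbrev Potential (ν : ℕ) : Type := lp (fun _ : Lattice ν => ℝ) ∞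

/-- The translation `(u(n))ₙ ↦ (u(n + j))ₙ`, as an isometry of `ℓ²(ℤ^ν)`. -/
noncomputable def shift {ν : ℕ} (j : Lattice ν) : Hilb ν →ₗᵢ[ℂ] Hilb ν where
  toFun u := ⟨fun n => u (n + j), memℓp_gen
    (((lp.memℓp u).summable (by norm_num)).comp_injective (add_left_injective j))⟩
  map_add' _ _ := rfl
  map_smul' _ _ := rfl
  norm_map' u := by
    rw [lp.norm_eq_tsum_rpow (by norm_num), lp.norm_eq_tsum_rpow (by norm_num)]
    exact congrArg (fun x : ℝ => x ^ (1 / (2 : ℝ≥0∞).toReal))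
      ((Equiv.addRight j).tsum_eq (fun n => ‖u n‖ ^ (2 : ℝ≥0∞).toReal))

theorem shift_apply {ν : ℕ} (j : Lattice ν) (u : Hilb ν) (n : Lattice ν) :
    shift j u n = u (n + j) := rfl

/-- The finite set of lattice vectors `j` with `|j| = 1`. -/
noncomputable def unitSteps (ν : ℕ) : Finset (Lattice ν) :=
  (Fintype.piFinset fun _ : Fin ν => Finset.Icc (-1 : ℤ) 1).filter fun j => len j = 1

theorem mem_unitSteps {ν : ℕ} (j : Lattice ν) : j ∈ unitSteps ν ↔ len j = 1 := by
  simp only [unitSteps, Finset.mem_filter, Fintype.mem_piFinset, Finset.mem_Icc,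
    and_iff_right_iff_imp]
  intro h i
  have hi : |j i| ≤ len j :=
    Finset.single_le_sum (f := fun i => |j i|) (fun i _ => abs_nonneg (j i)) (Finset.mem_univ i)
  exact abs_le.mp (h ▸ hi)

/-- The free operator `(H₀ u)(n) = ∑_{|j| = 1} u(n + j)` on `ℓ²(ℤ^ν)`. -/
noncomputable def freeOp (ν : ℕ) : Hilb ν →L[ℂ] Hilb ν :=
  ∑ j ∈ unitSteps ν, (shift j).toContinuousLinearMap

theorem freeOp_apply {ν : ℕ} (u : Hilb ν) (n : Lattice ν) :
    freeOp ν u n = ∑ j ∈ unitSteps ν, u (n + j) := by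
  have h : freeOp ν u = ∑ j ∈ unitSteps ν, shift j u := by simp [freeOp]
  rw [h, lp.coeFn_sum, Finset.sum_apply]
  rfl

theorem norm_ofReal_mul_le {ν : ℕ} (V : Potential ν) (u : Hilb ν) (n : Lattice ν) :
    ‖(V n : ℂ) * u n‖ ≤ ‖((‖V‖ : ℂ) • u) n‖ := by
  have h := lp.norm_apply_le_norm (by simp) V n
  simp only [lp.coeFn_smul, Pi.smul_apply, smul_eq_mul, norm_mul, Complex.norm_real, norm_norm]
  gcongr

/-- The operator of multiplication by a bounded potential, `(V u)(n) = V(n) u(n)`. -/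
noncomputable def mulOp {ν : ℕ} (V : Potential ν) : Hilb ν →L[ℂ] Hilb ν :=
  LinearMap.mkContinuous
    { toFun := fun u => (⟨fun n => (V n : ℂ) * u n,
        (lp.memℓp ((‖V‖ : ℂ) • u)).mono' (norm_ofReal_mul_le V u)⟩ : Hilb ν)
      map_add' := fun u v => by
        ext n
        exact mul_add _ _ _
      map_smul' := fun c u => by
        ext n
        exact mul_left_comm _ _ _ }
    ‖V‖ (fun u => by
      have h := lp.norm_mono (p := 2) (by norm_num)
        (x := (⟨fun n => (V n : ℂ) * u n,
          (lp.memℓp ((‖V‖ : ℂ) • u)).mono' (norm_ofReal_mul_le V u)⟩ : Hilb ν))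
        (y := (‖V‖ : ℂ) • u) (norm_ofReal_mul_le V u)
      rw [norm_smul, Complex.norm_real, norm_norm] at h
      exact h)

theorem mulOp_apply {ν : ℕ} (V : Potential ν) (u : Hilb ν) (n : Lattice ν) :
    mulOp V u n = (V n : ℂ) * u n := rfl

/-- The discrete Schrödinger operator `H₀ + V`. -/
noncomputable def schrodingerOp {ν : ℕ} (V : Potential ν) : Hilb ν →L[ℂ] Hilb ν :=
  freeOp ν + mulOp V

/-- The real interval `[-2ν, 2ν]`, as a subset of `ℂ`. -/
def freeBand (ν : ℕ) : Set ℂ := Complex.ofReal '' Set.Icc (-(2 * (ν : ℝ))) (2 * (ν : ℝ))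

/-- The essential spectrum of a bounded self-adjoint operator: the spectrum without the
isolated points of the spectrum that are eigenvalues of finite multiplicity. (An isolated point
of the spectrum of a self-adjoint operator is always an eigenvalue.) -/
def essSpectrum {ν : ℕ} (T : Hilb ν →L[ℂ] Hilb ν) : Set ℂ :=
  {z ∈ spectrum ℂ T | ¬ (𝓝[spectrum ℂ T \ {z}] z = ⊥ ∧
    FiniteDimensional ℂ (T - z • ContinuousLinearMap.id ℂ (Hilb ν)).ker)}

/-- `V` is sparse: the gaps between points of its support tend to infinity, that is, for every
`R` only finitely many pairs of distinct points of the support have distance at most `R`. -/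
def IsSparse {ν : ℕ} (V : Potential ν) : Prop :=
  ∀ R : ℤ, {p : Lattice ν × Lattice ν |
    V p.1 ≠ 0 ∧ V p.2 ≠ 0 ∧ p.1 ≠ p.2 ∧ len (p.1 - p.2) ≤ R}.Finite

/-- `|n| → ∞` in `ℤ^ν`: the filter generated by the sets `{n | |n| ≥ R}`. -/
noncomputable def atInfty (ν : ℕ) : Filter (Lattice ν) := comap len atTop

theorem atInfty_eq_cofinite (ν : ℕ) : atInfty ν = cofinite := by
  apply le_antisymm
  · rw [le_cofinite_iff_compl_singleton_mem]
    intro n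
    refine mem_comap.mpr ⟨Set.Ioi (len n), Ioi_mem_atTop _, ?_⟩
    rintro m hm rfl
    exact lt_irrefl (len m) hm
  · refine tendsto_iff_comap.mp (tendsto_atTop.mpr fun R => ?_)
    refine (Set.Finite.subset (Fintype.piFinset fun _ : Fin ν =>
      Finset.Icc (-R) R).finite_toSet fun n hn => ?_)
    have hn' : len n < R := by simpa using hn
    simp only [Finset.mem_coe, Fintype.mem_piFinset, Finset.mem_Icc]
    intro i
    have hi : |n i| ≤ len n :=
      Finset.single_le_sum (f := fun i => |n i|) (fun i _ => abs_nonneg (n i)) (Finset.mem_univ i)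
    exact abs_le.mp (hi.trans hn'.le)

end DiscreteSchrodinger

namespace DiscreteSchrodinger

/-! The potential is 1/12 at the points 4^k e_i and 0 elsewhere. The upper edge of the band rests on
the form inequality V ≤ 2ν - H₀, that is, ∑ₖ |u(4^k e_i)|² is at most 12 times the Dirichlet energy
of u (`sum_norm_sq_sparsePoint_le`). This is a quantitative form of transience of the random walk
for ν ≥ 3: a unit flow from a point to infinity can have finite energy. The flow used is the Pólya
urn on an orthant, which carries the uniform distribution on each simplex ∑ x_i = n to that on the
next; beyond level L its energy is at most 2/(L + 1). Hence |u(p)|² is bounded by 4 times the energy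
in the first L levels above p plus 4/(L + 1) times the total energy (`norm_apply_zero_sq_le`). With
L = 2^k at 4^k e_i the near regions are disjoint and the far terms are summable.

Since also V ≥ 0 and H₀ ≥ -2ν, the spectrum lies in the band (`spectrum_subset_of_form_bounds`).
Conversely, V vanishes on the open positive orthant, which contains arbitrarily large cubes, so
truncated plane waves give approximate eigenvectors for every point of the band
(`freeBand_subset_spectrum`). -/

/-! ### The Pólya urn flow and bounds for point values -/

/-- The points of `ℕ^ν` with coordinate sum `n`. -/
def simplex (ν n : ℕ) : Finset (Fin ν → ℕ) := Finset.univ.piAntidiag n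

theorem mem_simplex {ν n : ℕ} {x : Fin ν → ℕ} : x ∈ simplex ν n ↔ ∑ i, x i = n := by
  simp [simplex]

/-- The Pólya urn flow transports the uniform distribution on one simplex to the next. -/
theorem sum_simplex_succ {ν : ℕ} (n : ℕ) (f : (Fin ν → ℕ) → ℂ) :
    ∑ x ∈ simplex ν n, ∑ i, ((x i : ℂ) + 1) * f (x + Pi.single i 1) =
      (n + 1) * ∑ y ∈ simplex ν (n + 1), f y := by
  have h1 : (n + 1) * ∑ y ∈ simplex ν (n + 1), f y =
      ∑ y ∈ simplex ν (n + 1), ∑ i, (y i : ℂ) * f y := by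
    rw [Finset.mul_sum]
    refine Finset.sum_congr rfl fun y hy => ?_
    rw [← Finset.sum_mul, ← Nat.cast_sum, mem_simplex.mp hy]
    push_cast
    rfl
  rw [h1, Finset.sum_comm, Finset.sum_comm (s := simplex ν (n + 1))]
  refine Finset.sum_congr rfl fun i _ => ?_
  refine Finset.sum_of_injOn (fun x => x + Pi.single i 1) (add_left_injective _).injOn ?_ ?_ ?_
  · intro x hx
    have hx' := mem_simplex.mp hx
    exact mem_simplex.mpr (by simp [Finset.sum_add_distrib, hx', Pi.single_apply])
  -- A point outside the image of the shift by e_i lies on the face y i = 0, where its weight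
  -- vanishes.
  · intro y hy hy'
    have : y i = 0 := by
      by_contra h
      refine hy' ⟨y - Pi.single i 1, ?_, ?_⟩
      · have hle : ∀ j, Pi.single (M := fun _ => ℕ) i 1 j ≤ y j := by
          intro j
          by_cases hj : j = i
          · subst hj; simp; omega
          · simp [hj]
        refine mem_simplex.mpr ?_
        simp only [Pi.sub_apply]
        rw [Finset.sum_tsub_distrib _ fun j _ => hle j, mem_simplex.mp hy]
        simp [Pi.single_apply]
      · ext j
        by_cases hj : j = i
        · subst hj; simp; omega
        · simp [hj]
    simp [this]
  · intro x _
    simp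

theorem card_simplex_succ (ν n : ℕ) :
    (n + ν) * (simplex ν n).card = (n + 1) * (simplex ν (n + 1)).card := by
  have h := sum_simplex_succ (ν := ν) n fun _ => 1
  have h2 : ∀ x ∈ simplex ν n, ∑ i, ((x i : ℂ) + 1) * 1 = n + ν := by
    intro x hx
    simp [Finset.sum_add_distrib, ← Nat.cast_sum, mem_simplex.mp hx]
  rw [Finset.sum_congr rfl h2] at h
  simp only [Finset.sum_const, nsmul_eq_mul, mul_one] at h
  rw [mul_comm]
  exact_mod_cast h

/-- Quadratic growth of the simplices, with equality for ν = 3. It makes the inverse cardinalities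
summable, which is where transience enters. -/
theorem le_two_mul_card_simplex {ν : ℕ} (hν : 3 ≤ ν) (n : ℕ) :
    (n + 1) * (n + 2) ≤ 2 * (simplex ν n).card := by
  induction n with
  | zero =>
    have : (0 : Fin ν → ℕ) ∈ simplex ν 0 := mem_simplex.mpr (by simp)
    have := Finset.card_pos.mpr ⟨_, this⟩
    omega
  | succ n ih =>
    have h := card_simplex_succ ν n
    have h3 : (n + 3) * (simplex ν n).card ≤ (n + ν) * (simplex ν n).card :=
      Nat.mul_le_mul_right _ (by omega)
    refine Nat.le_of_mul_le_mul_left (c := n + 1) ?_ (by omega)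
    nlinarith

/-- The average of a function over the `n`-th simplex. -/
noncomputable def simplexAvg {ν : ℕ} (f : (Fin ν → ℕ) → ℂ) (n : ℕ) : ℂ :=
  ((simplex ν n).card : ℂ)⁻¹ * ∑ x ∈ simplex ν n, f x

/-- The energy of a function on the edges leaving the `n`-th simplex. -/
noncomputable def simplexEnergy {ν : ℕ} (f : (Fin ν → ℕ) → ℂ) (n : ℕ) : ℝ :=
  ∑ x ∈ simplex ν n, ∑ i, ‖f (x + Pi.single i 1) - f x‖ ^ 2

theorem simplexEnergy_nonneg {ν : ℕ} (f : (Fin ν → ℕ) → ℂ) (n : ℕ) : 0 ≤ simplexEnergy f n := by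
  unfold simplexEnergy
  positivity

theorem simplexAvg_zero {ν : ℕ} (f : (Fin ν → ℕ) → ℂ) : simplexAvg f 0 = f 0 := by
  have : simplex ν 0 = {0} := by
    ext x
    simp [mem_simplex, funext_iff]
  simp [simplexAvg, this]

theorem norm_sum_sq_le {ι : Type*} (s : Finset ι) (a : ι → ℝ) (b : ι → ℂ) :
    ‖∑ i ∈ s, (a i : ℂ) * b i‖ ^ 2 ≤ (∑ i ∈ s, a i ^ 2) * ∑ i ∈ s, ‖b i‖ ^ 2 := by
  calc _ ≤ (∑ i ∈ s, |a i| * ‖b i‖) ^ 2 := by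
        gcongr
        refine (norm_sum_le _ _).trans (le_of_eq (Finset.sum_congr rfl fun i _ => ?_))
        simp
    _ ≤ (∑ i ∈ s, |a i| ^ 2) * ∑ i ∈ s, ‖b i‖ ^ 2 := Finset.sum_mul_sq_le_sq_mul_sq _ _ _
    _ = _ := by simp

/-- The difference of averages is the sum of the gradients of f against the flow. The flow out of
each vertex totals 1/card, so the squares of the flow over all edges sum to at most 1/card, and
Cauchy–Schwarz applies. -/
theorem norm_simplexAvg_succ_sub_sq_le {ν : ℕ} (hν : 3 ≤ ν) (f : (Fin ν → ℕ) → ℂ) (n : ℕ) :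
    ‖simplexAvg f (n + 1) - simplexAvg f n‖ ^ 2 ≤
      2 / ((n + 1) * (n + 2) : ℝ) * simplexEnergy f n := by
  have hc := le_two_mul_card_simplex hν n
  have hc0 : 0 < (simplex ν n).card := by nlinarith
  have hc1 : 0 < (simplex ν (n + 1)).card := by
    have := le_two_mul_card_simplex hν (n + 1)
    nlinarith
  set c := (simplex ν n).card with hcdef
  have hcs : ((n : ℂ) + ν) * c = (n + 1) * ((simplex ν (n + 1)).card : ℂ) := by
    exact_mod_cast card_simplex_succ ν n
  have hnν : (0 : ℝ) < n + ν := by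
    have : (3 : ℝ) ≤ ν := by exact_mod_cast hν
    positivity
  have hcC : (c : ℂ) ≠ 0 := by exact_mod_cast hc0.ne'
  have hc1C : ((simplex ν (n + 1)).card : ℂ) ≠ 0 := by exact_mod_cast hc1.ne'
  have hw : ∀ x ∈ simplex ν n, ∑ i, ((x i : ℂ) + 1) = n + ν := by
    intro x hx
    simp [Finset.sum_add_distrib, ← Nat.cast_sum, mem_simplex.mp hx]
  have hsum : ∑ p ∈ simplex ν n ×ˢ (Finset.univ : Finset (Fin ν)),
      (((p.1 p.2 : ℝ) + 1 : ℝ) : ℂ) * (f (p.1 + Pi.single p.2 1) - f p.1) =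
      (n + ν) * c * (simplexAvg f (n + 1) - simplexAvg f n) := by
    rw [Finset.sum_product]
    push_cast
    simp only [mul_sub, Finset.sum_sub_distrib]
    rw [sum_simplex_succ]
    have : ∑ x ∈ simplex ν n, ∑ i, ((x i : ℂ) + 1) * f x = (n + ν) * ∑ x ∈ simplex ν n, f x := by
      rw [Finset.mul_sum]
      exact Finset.sum_congr rfl fun x hx => by rw [← Finset.sum_mul, hw x hx]
    rw [this, hcs]
    simp only [simplexAvg, ← hcdef]
    rw [mul_assoc ((n : ℂ) + 1), mul_inv_cancel_left₀ hc1C, ← mul_assoc _ (_)⁻¹, ← hcs,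
      mul_inv_cancel_right₀ hcC]
  have hwt : ∑ p ∈ simplex ν n ×ˢ (Finset.univ : Finset (Fin ν)), ((p.1 p.2 : ℝ) + 1) ^ 2 ≤
      (c : ℝ) * ((n : ℝ) + ν) ^ 2 := by
    rw [Finset.sum_product, ← nsmul_eq_mul]
    refine Finset.sum_le_card_nsmul _ _ _ fun x hx => ?_
    have h1 : ∑ i, ((x i : ℝ) + 1) = n + ν := by exact_mod_cast hw x hx
    rw [← h1]
    exact Finset.sum_sq_le_sq_sum_of_nonneg fun i _ => by positivity
  have hE : ∑ p ∈ simplex ν n ×ˢ (Finset.univ : Finset (Fin ν)),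
      ‖f (p.1 + Pi.single p.2 1) - f p.1‖ ^ 2 = simplexEnergy f n := Finset.sum_product _ _ _
  have hcs2 := norm_sum_sq_le (simplex ν n ×ˢ (Finset.univ : Finset (Fin ν)))
    (fun p => (p.1 p.2 : ℝ) + 1) fun p => f (p.1 + Pi.single p.2 1) - f p.1
  have hE0 := simplexEnergy_nonneg f n
  rw [hsum, hE, norm_mul, mul_pow] at hcs2
  have hnorm : ‖((n : ℂ) + ν) * c‖ = (n + ν) * c := by
    exact_mod_cast Complex.norm_natCast ((n + ν) * c)
  rw [hnorm] at hcs2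
  have hcR : (0 : ℝ) < c := by exact_mod_cast hc0
  have h4 : ‖simplexAvg f (n + 1) - simplexAvg f n‖ ^ 2 ≤ 1 / c * simplexEnergy f n := by
    have h5 := hcs2.trans (mul_le_mul_of_nonneg_right hwt hE0)
    have h6 : 0 < c * ((n : ℝ) + ν) ^ 2 := by positivity
    rw [div_mul_eq_mul_div, one_mul, le_div_iff₀ hcR]
    refine le_of_mul_le_mul_left ?_ h6
    nlinarith
  refine h4.trans (mul_le_mul_of_nonneg_right (?_ : (1 : ℝ) / c ≤ _) hE0)
  rw [div_le_div_iff₀ hcR (by positivity)]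
  rw [one_mul]
  exact_mod_cast hc

theorem sum_Ico_two_div_le {L N : ℕ} (h : L ≤ N) :
    ∑ n ∈ Finset.Ico L N, 2 / ((n + 1) * (n + 2) : ℝ) = 2 / (L + 1) - 2 / (N + 1) := by
  induction N, h using Nat.le_induction with
  | base => simp
  | succ N hN ih =>
    rw [Finset.sum_Ico_succ_top hN, ih]
    push_cast
    field_simp
    ring

/-- Cauchy–Schwarz across the levels; the weights telescope, leaving the tail 2/(L + 1). -/
theorem norm_simplexAvg_sub_sq_le {ν : ℕ} (hν : 3 ≤ ν) (f : (Fin ν → ℕ) → ℂ) {L N : ℕ}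
    (h : L ≤ N) :
    ‖simplexAvg f N - simplexAvg f L‖ ^ 2 ≤
      2 / (L + 1 : ℝ) * ∑ n ∈ Finset.Ico L N, simplexEnergy f n := by
  have h1 : ‖simplexAvg f N - simplexAvg f L‖ ≤
      ∑ n ∈ Finset.Ico L N, ‖simplexAvg f (n + 1) - simplexAvg f n‖ := by
    rw [← dist_eq_norm, dist_comm]
    refine (dist_le_Ico_sum_dist _ h).trans (le_of_eq (Finset.sum_congr rfl fun n _ => ?_))
    rw [dist_comm, dist_eq_norm]
  calc _ ≤ (∑ n ∈ Finset.Ico L N, ‖simplexAvg f (n + 1) - simplexAvg f n‖) ^ 2 := by gcongr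
    _ ≤ (∑ n ∈ Finset.Ico L N, 2 / ((n + 1) * (n + 2) : ℝ)) *
          ∑ n ∈ Finset.Ico L N, simplexEnergy f n :=
        Finset.sum_sq_le_sum_mul_sum_of_sq_le_mul _ (fun n _ => by positivity)
          (fun n _ => simplexEnergy_nonneg f n) fun n _ => norm_simplexAvg_succ_sub_sq_le hν f n
    _ ≤ _ := by
        refine mul_le_mul_of_nonneg_right ?_ (Finset.sum_nonneg fun n _ => simplexEnergy_nonneg f n)
        rw [sum_Ico_two_div_le h, sub_le_self_iff]
        positivity

/-- Averages over large simplices of a square summable function tend to zero. -/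
theorem tendsto_simplexAvg {ν : ℕ} (hν : 3 ≤ ν) (f : (Fin ν → ℕ) → ℂ)
    (hf : Summable fun x => ‖f x‖ ^ 2) : Tendsto (simplexAvg f) atTop (𝓝 0) := by
  rw [tendsto_zero_iff_norm_tendsto_zero]
  have key : ∀ n : ℕ, ‖simplexAvg f n‖ ^ 2 ≤ (∑' x, ‖f x‖ ^ 2) * (1 / ((n : ℝ) + 1)) := by
    intro n
    have hc := le_two_mul_card_simplex hν n
    have hc0 : 0 < (simplex ν n).card := by nlinarith
    have h := norm_sum_sq_le (simplex ν n) (fun _ => 1) f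
    simp only [Complex.ofReal_one, one_mul, one_pow, Finset.sum_const, nsmul_eq_mul, mul_one] at h
    have h2 : ∑ x ∈ simplex ν n, ‖f x‖ ^ 2 ≤ ∑' x, ‖f x‖ ^ 2 :=
      hf.sum_le_tsum _ fun _ _ => by positivity
    have h3 : (0 : ℝ) ≤ ∑' x, ‖f x‖ ^ 2 := tsum_nonneg fun _ => by positivity
    have hcR : (0 : ℝ) < (simplex ν n).card := by exact_mod_cast hc0
    have hcn : (n : ℝ) + 1 ≤ (simplex ν n).card := by
      have : n + 1 ≤ (simplex ν n).card := by nlinarith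
      exact_mod_cast this
    unfold simplexAvg
    rw [norm_mul, norm_inv, Complex.norm_natCast, mul_pow]
    calc _ ≤ (((simplex ν n).card : ℝ)⁻¹) ^ 2 *
          ((simplex ν n).card * ∑' x, ‖f x‖ ^ 2) := by gcongr; exact h.trans (by gcongr)
      _ = (∑' x, ‖f x‖ ^ 2) * (1 / (simplex ν n).card) := by field_simp
      _ ≤ _ := by gcongr
  have h1 : Tendsto (fun n => ‖simplexAvg f n‖ ^ 2) atTop (𝓝 0) := by
    refine squeeze_zero (fun n => by positivity) key ?_
    simpa using (tendsto_one_div_add_atTop_nhds_zero_nat (𝕜 := ℝ)).const_mul (∑' x, ‖f x‖ ^ 2)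
  simpa using h1.sqrt

theorem norm_simplexAvg_sq_le {ν : ℕ} (hν : 3 ≤ ν) (f : (Fin ν → ℕ) → ℂ)
    (hf : Summable fun x => ‖f x‖ ^ 2) {D : ℝ}
    (hD : ∀ s, ∑ n ∈ s, simplexEnergy f n ≤ D) (L : ℕ) :
    ‖simplexAvg f L‖ ^ 2 ≤ 2 / (L + 1 : ℝ) * D := by
  have h1 : Tendsto (fun N => ‖simplexAvg f N - simplexAvg f L‖ ^ 2) atTop
      (𝓝 (‖0 - simplexAvg f L‖ ^ 2)) :=
    (((tendsto_simplexAvg hν f hf).sub_const _).norm).pow 2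
  rw [zero_sub, norm_neg] at h1
  refine le_of_tendsto h1 ?_
  filter_upwards [eventually_ge_atTop L] with N hN
  refine (norm_simplexAvg_sub_sq_le hν f hN).trans ?_
  gcongr
  exact hD _

/-- A point value is controlled by the nearby energy and a small multiple of the total energy. -/
theorem norm_apply_zero_sq_le {ν : ℕ} (hν : 3 ≤ ν) (f : (Fin ν → ℕ) → ℂ)
    (hf : Summable fun x => ‖f x‖ ^ 2) {D : ℝ}
    (hD : ∀ s, ∑ n ∈ s, simplexEnergy f n ≤ D) (L : ℕ) :
    ‖f 0‖ ^ 2 ≤ 4 * ∑ n ∈ Finset.range L, simplexEnergy f n + 4 / (L + 1 : ℝ) * D := by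
  have h1 := norm_simplexAvg_sq_le hν f hf hD L
  have h2 := norm_simplexAvg_sub_sq_le hν f (Nat.zero_le L)
  rw [simplexAvg_zero, Nat.Ico_zero_eq_range] at h2
  norm_num at h2
  have h3 : ‖f 0‖ ≤ ‖simplexAvg f L‖ + ‖simplexAvg f L - f 0‖ := by
    simpa using norm_sub_le (simplexAvg f L) (simplexAvg f L - f 0)
  have h4 : ‖f 0‖ ^ 2 ≤ 2 * ‖simplexAvg f L‖ ^ 2 + 2 * ‖simplexAvg f L - f 0‖ ^ 2 := by
    nlinarith [sq_nonneg (‖simplexAvg f L‖ - ‖simplexAvg f L - f 0‖), norm_nonneg (f 0)]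
  have h5 : 4 / (L + 1 : ℝ) * D = 2 * (2 / (L + 1 : ℝ) * D) := by ring
  rw [h5]
  linarith

/-! ### The free operator, the Dirichlet energy and quadratic forms -/

/-- The unit vector of `ℤ^ν` in direction `i`. -/
abbrev unitVec {ν : ℕ} (i : Fin ν) : Lattice ν := Pi.single i 1

theorem len_single {ν : ℕ} (i : Fin ν) (a : ℤ) : len (Pi.single i a : Lattice ν) = |a| := by
  rw [len, Finset.sum_eq_single i]
  · simp
  · intro j _ hj
    simp [hj]
  · simp

theorem exists_eq_single_of_len_eq_one {ν : ℕ} {j : Lattice ν} (h : len j = 1) :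
    ∃ i, j = unitVec i ∨ j = -unitVec i := by
  obtain ⟨i, hi⟩ : ∃ i, j i ≠ 0 := by
    by_contra! h0
    simp [len, h0] at h
  refine ⟨i, ?_⟩
  have h1 : |j i| + ∑ k ∈ Finset.univ.erase i, |j k| = 1 :=
    (Finset.add_sum_erase _ (fun k => |j k|) (Finset.mem_univ i)).trans h
  have h2 : 0 ≤ ∑ k ∈ Finset.univ.erase i, |j k| := Finset.sum_nonneg fun _ _ => abs_nonneg _
  have h3 : 1 ≤ |j i| := Int.one_le_abs hi
  have h4 : ∀ k, k ≠ i → j k = 0 := by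
    intro k hk
    have h5 := (Finset.sum_eq_zero_iff_of_nonneg fun k _ => abs_nonneg (j k)).mp
      (show ∑ k ∈ Finset.univ.erase i, |j k| = 0 by omega) k (by simp [hk])
    exact abs_eq_zero.mp h5
  rcases (abs_eq (by norm_num : (0 : ℤ) ≤ 1)).mp (show |j i| = 1 by omega) with h5 | h5
  · left
    ext k
    by_cases hk : k = i
    · subst hk; simp [h5]
    · simp [hk, h4 k hk]
  · right
    ext k
    by_cases hk : k = i
    · subst hk; simp [h5]
    · simp [hk, h4 k hk]

theorem unitVec_ne_neg_unitVec {ν : ℕ} (i k : Fin ν) : unitVec i ≠ -unitVec k := by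
  intro h
  have h1 := congrFun h i
  by_cases hk : i = k
  · subst hk; simp at h1
  · simp [hk] at h1

theorem unitVec_injective {ν : ℕ} : Function.Injective (unitVec : Fin ν → Lattice ν) := by
  intro i k h
  by_contra hk
  have h1 := congrFun h i
  simp [hk] at h1

theorem sum_unitSteps {ν : ℕ} {M : Type*} [AddCommMonoid M] (g : Lattice ν → M) :
    ∑ j ∈ unitSteps ν, g j = ∑ i, (g (unitVec i) + g (-unitVec i)) := by
  classical
  have h : unitSteps ν = Finset.univ.image unitVec ∪ Finset.univ.image fun i => -unitVec i := by
    ext j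
    simp only [mem_unitSteps, Finset.mem_union, Finset.mem_image, Finset.mem_univ, true_and]
    constructor
    · intro hj
      obtain ⟨i, rfl | rfl⟩ := exists_eq_single_of_len_eq_one hj
      · exact Or.inl ⟨i, rfl⟩
      · exact Or.inr ⟨i, rfl⟩
    · rintro (⟨i, rfl⟩ | ⟨i, rfl⟩)
      · simp [len_single]
      · rw [unitVec, ← Pi.single_neg, len_single]
        simp
  rw [h, Finset.sum_union, Finset.sum_image, Finset.sum_image, Finset.sum_add_distrib]
  · exact fun i _ k _ hik => unitVec_injective (neg_injective hik)
  · exact unitVec_injective.injOn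
  · rw [Finset.disjoint_left]
    simp only [Finset.mem_image, Finset.mem_univ, true_and, not_exists]
    rintro _ ⟨i, rfl⟩ k hk
    exact unitVec_ne_neg_unitVec i k hk.symm

theorem freeOp_eq {ν : ℕ} (u : Hilb ν) :
    freeOp ν u = ∑ i, (shift (unitVec i) u + shift (-unitVec i) u) := by
  rw [← sum_unitSteps fun j => shift j u]
  simp [freeOp]

theorem shift_shift_neg {ν : ℕ} (j : Lattice ν) (u : Hilb ν) : shift j (shift (-j) u) = u := by
  ext n
  simp [shift_apply]

theorem inner_shift_neg_left {ν : ℕ} (j : Lattice ν) (u v : Hilb ν) :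
    inner ℂ (shift (-j) u) v = inner ℂ u (shift j v) := by
  rw [← (shift j).inner_map_map, shift_shift_neg]

theorem inner_shift_left {ν : ℕ} (j : Lattice ν) (u v : Hilb ν) :
    inner ℂ (shift j u) v = inner ℂ u (shift (-j) v) := by
  rw [← inner_shift_neg_left, neg_neg]

theorem isSelfAdjoint_freeOp (ν : ℕ) : IsSelfAdjoint (freeOp ν) := by
  rw [ContinuousLinearMap.isSelfAdjoint_iff_isSymmetric]
  intro u v
  change inner ℂ (freeOp ν u) v = inner ℂ u (freeOp ν v)
  rw [freeOp_eq, freeOp_eq, sum_inner, inner_sum]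
  refine Finset.sum_congr rfl fun i _ => ?_
  rw [inner_add_left, inner_add_right, inner_shift_neg_left, inner_shift_left, add_comm]

theorem isSelfAdjoint_mulOp {ν : ℕ} (V : Potential ν) : IsSelfAdjoint (mulOp V) := by
  rw [ContinuousLinearMap.isSelfAdjoint_iff_isSymmetric]
  intro u v
  change inner ℂ (mulOp V u) v = inner ℂ u (mulOp V v)
  rw [lp.inner_eq_tsum, lp.inner_eq_tsum]
  refine tsum_congr fun n => ?_
  change inner ℂ ((V n : ℂ) • u n) (v n) = inner ℂ (u n) ((V n : ℂ) • v n)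
  rw [inner_smul_left, inner_smul_right, Complex.conj_ofReal]

theorem isSelfAdjoint_schrodingerOp {ν : ℕ} (V : Potential ν) :
    IsSelfAdjoint (schrodingerOp V) :=
  (isSelfAdjoint_freeOp ν).add (isSelfAdjoint_mulOp V)

theorem re_inner_freeOp {ν : ℕ} (u : Hilb ν) :
    (inner ℂ (freeOp ν u) u).re = ∑ i, 2 * (inner ℂ (shift (unitVec i) u) u).re := by
  rw [freeOp_eq, sum_inner, Complex.re_sum]
  refine Finset.sum_congr rfl fun i _ => ?_
  rw [inner_add_left, inner_shift_neg_left, Complex.add_re, ← inner_conj_symm u, Complex.conj_re]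
  ring

/-- The Dirichlet energy. -/
noncomputable def energy {ν : ℕ} (u : Hilb ν) : ℝ := ∑ i, ‖shift (unitVec i) u - u‖ ^ 2

/-- Identifies the energy with the form of 2ν - H₀, so that a bound of V by the energy is a bound of
H₀ + V by 2ν. -/
theorem energy_eq {ν : ℕ} (u : Hilb ν) :
    energy u = 2 * ν * ‖u‖ ^ 2 - (inner ℂ (freeOp ν u) u).re := by
  have h : ∀ i : Fin ν, ‖shift (unitVec i) u - u‖ ^ 2 =
      2 * ‖u‖ ^ 2 - 2 * (inner ℂ (shift (unitVec i) u) u).re := by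
    intro i
    rw [norm_sub_sq (𝕜 := ℂ), LinearIsometry.norm_map]
    simp only [RCLike.re_to_complex]
    ring
  simp only [energy, h, re_inner_freeOp, Finset.sum_sub_distrib, Finset.sum_const,
    Finset.card_univ, Fintype.card_fin, nsmul_eq_mul]
  ring

theorem neg_le_re_inner_freeOp {ν : ℕ} (u : Hilb ν) :
    -(2 * ν * ‖u‖ ^ 2) ≤ (inner ℂ (freeOp ν u) u).re := by
  have h : ∀ i : Fin ν, -(2 * ‖u‖ ^ 2) ≤ 2 * (inner ℂ (shift (unitVec i) u) u).re := by
    intro i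
    have h1 := norm_add_sq (𝕜 := ℂ) (shift (unitVec i) u) u
    rw [LinearIsometry.norm_map] at h1
    simp only [RCLike.re_to_complex] at h1
    nlinarith [sq_nonneg ‖shift (unitVec i) u + u‖]
  rw [re_inner_freeOp]
  calc -(2 * ν * ‖u‖ ^ 2) = ∑ _i : Fin ν, -(2 * ‖u‖ ^ 2) := by
        simp
        ring
    _ ≤ _ := Finset.sum_le_sum fun i _ => h i

theorem hasSum_norm_sq {ν : ℕ} (u : Hilb ν) : HasSum (fun n => ‖u n‖ ^ 2) (‖u‖ ^ 2) := by
  have h := lp.hasSum_inner (𝕜 := ℂ) u u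
  simp only [inner_self_eq_norm_sq_to_K] at h
  exact_mod_cast h

theorem hasSum_mulOp {ν : ℕ} (V : Potential ν) (u : Hilb ν) :
    HasSum (fun n => V n * ‖u n‖ ^ 2) (inner ℂ (mulOp V u) u).re := by
  have h := Complex.hasSum_re (lp.hasSum_inner (𝕜 := ℂ) (mulOp V u) u)
  refine h.congr_fun fun n => ?_
  change _ = (inner ℂ ((V n : ℂ) • u n) (u n)).re
  rw [inner_smul_left, inner_self_eq_norm_sq_to_K, Complex.conj_ofReal]
  have hcast : (V n : ℂ) * (‖u n‖ : ℂ) ^ 2 = ((V n * ‖u n‖ ^ 2 : ℝ) : ℂ) := by push_cast; rfl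
  exact (congrArg Complex.re hcast).symm

theorem hasSum_energy {ν : ℕ} (u : Hilb ν) :
    HasSum (fun n => ∑ i, ‖u (n + unitVec i) - u n‖ ^ 2) (energy u) :=
  hasSum_sum fun i _ => hasSum_norm_sq (shift (unitVec i) u - u)

/-- The spectrum of a self-adjoint operator lies between its quadratic form bounds. -/
theorem spectrum_subset_of_form_bounds {H : Type*} [NormedAddCommGroup H] [InnerProductSpace ℂ H]
    [CompleteSpace H] {T : H →L[ℂ] H} (hT : IsSelfAdjoint T) {a b : ℝ}
    (ha : ∀ u, a * ‖u‖ ^ 2 ≤ (inner ℂ (T u) u).re)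
    (hb : ∀ u, (inner ℂ (T u) u).re ≤ b * ‖u‖ ^ 2) :
    spectrum ℂ T ⊆ Complex.ofReal '' Set.Icc a b := by
  have hsa : ∀ r : ℝ, IsSelfAdjoint (algebraMap ℝ (H →L[ℂ] H) r) := fun r =>
    IsSelfAdjoint.algebraMap _ (IsSelfAdjoint.all r)
  have hin : ∀ (r : ℝ) (u : H), (inner ℂ (algebraMap ℝ (H →L[ℂ] H) r u) u).re = r * ‖u‖ ^ 2 := by
    intro r u
    have : algebraMap ℝ (H →L[ℂ] H) r u = (r : ℂ) • u := by
      rw [Algebra.algebraMap_eq_smul_one]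
      simp
    rw [this, inner_smul_left, inner_self_eq_norm_sq_to_K]
    rw [Complex.conj_ofReal]
    have hcast : (r : ℂ) * (‖u‖ : ℂ) ^ 2 = ((r * ‖u‖ ^ 2 : ℝ) : ℂ) := by push_cast; rfl
    exact congrArg Complex.re hcast
  have hpos : ∀ S : H →L[ℂ] H, IsSelfAdjoint S → (∀ u, 0 ≤ (inner ℂ (S u) u).re) → 0 ≤ S := by
    intro S hS h
    rw [ContinuousLinearMap.nonneg_iff_isPositive]
    exact (ContinuousLinearMap.isPositive_def' ).mpr ⟨hS, h⟩
  intro z hz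
  have hre := hT.mem_spectrum_eq_re hz
  have hr : z.re ∈ spectrum ℝ T := by
    rw [hre] at hz
    exact (spectrum.algebraMap_mem_iff ℂ).mp hz
  refine ⟨z.re, ⟨?_, ?_⟩, hre.symm⟩
  · have h1 : 0 ≤ algebraMap ℝ _ (-a) + T := by
      refine hpos _ ((hsa _).add hT) fun u => ?_
      rw [add_apply, inner_add_left, Complex.add_re, hin]
      linarith [ha u]
    have h2 := spectrum_nonneg_of_nonneg h1 (spectrum.add_mem_add_iff.mpr hr)
    linarith
  · have h1 : 0 ≤ algebraMap ℝ _ b - T := by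
      refine hpos _ ((hsa _).sub hT) fun u => ?_
      rw [sub_apply, inner_sub_left, Complex.sub_re, hin]
      linarith [hb u]
    have h2 : b - z.re ∈ spectrum ℝ (algebraMap ℝ _ b - T) := by
      rw [← spectrum.singleton_sub_eq]
      exact Set.sub_mem_sub rfl hr
    linarith [spectrum_nonneg_of_nonneg h1 h2]

/-! ### The Hardy-type inequality at the sparse points -/

/-- The centres of the sparse potential. -/
def sparsePoint {ν : ℕ} (i : Fin ν) (k : ℕ) : Lattice ν := Pi.single i (4 ^ k)

theorem sparsePoint_injective {ν : ℕ} (i : Fin ν) : Function.Injective (sparsePoint i) := by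
  intro k l h
  have h1 : (4 : ℤ) ^ k = 4 ^ l := Pi.single_injective (M := fun _ => ℤ) i h
  exact Int.pow_right_injective (a := 4) (by norm_num) h1

theorem sum_comp_le_of_hasSum {α β : Type*} {g : β → ℝ} {a : ℝ} (hg : HasSum g a)
    (h0 : ∀ b, 0 ≤ g b) (t : Finset α) (φ : α → β) (hφ : Set.InjOn φ t) :
    ∑ x ∈ t, g (φ x) ≤ a := by
  classical
  rw [← Finset.sum_image (f := g) hφ]
  exact sum_le_hasSum _ (fun b _ => h0 b) hg

/-- The inclusion of the positive orthant in the lattice. -/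
def natPoint {ν : ℕ} (x : Fin ν → ℕ) : Lattice ν := fun i => (x i : ℤ)

theorem natPoint_injective {ν : ℕ} : Function.Injective (natPoint : (Fin ν → ℕ) → Lattice ν) := by
  intro x y h
  ext i
  exact Int.natCast_inj.mp (congrFun h i)

theorem natPoint_add_single {ν : ℕ} (x : Fin ν → ℕ) (i : Fin ν) :
    natPoint (x + Pi.single i 1) = natPoint x + unitVec i := by
  ext j
  by_cases hj : j = i
  · subst hj; simp [natPoint]
  · simp [natPoint, hj]

theorem natPoint_zero {ν : ℕ} : natPoint (0 : Fin ν → ℕ) = 0 := by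
  ext j
  simp [natPoint]

theorem simplexEnergy_translate {ν : ℕ} (u : Hilb ν) (p : Lattice ν) (n : ℕ) :
    simplexEnergy (fun x => u (p + natPoint x)) n =
      ∑ x ∈ simplex ν n, ∑ i, ‖u (p + natPoint x + unitVec i) - u (p + natPoint x)‖ ^ 2 := by
  simp only [simplexEnergy, natPoint_add_single, add_assoc]

theorem lt_of_mem_simplex {ν n L : ℕ} {x : Fin ν → ℕ} (hx : x ∈ simplex ν n) (hn : n < L)
    (i : Fin ν) : x i < L := by
  have h := Finset.single_le_sum (f := x) (fun _ _ => Nat.zero_le _) (Finset.mem_univ i)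
  rw [mem_simplex.mp hx] at h
  omega

/-- The simplices attached to different sparse points are disjoint. -/
theorem sparsePoint_add_natPoint_ne {ν : ℕ} (i : Fin ν) {k l : ℕ} (hkl : k < l)
    {x y : Fin ν → ℕ} (hx : x i < 2 ^ k) :
    sparsePoint i k + natPoint x ≠ sparsePoint i l + natPoint y := by
  intro h
  have h1 : (4 : ℤ) ^ k + x i = 4 ^ l + y i := by simpa [sparsePoint, natPoint] using congrFun h i
  have h2 : 4 ^ k + x i = 4 ^ l + y i := by exact_mod_cast h1
  -- In direction i the left point stays below 2 · 4^k, hence below 4^(k + 1) ≤ 4^l.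
  have h3 : 4 ^ (k + 1) ≤ 4 ^ l := Nat.pow_le_pow_right (by norm_num) hkl
  have h4 : 2 ^ k ≤ 4 ^ k := Nat.pow_le_pow_left (by norm_num) k
  rw [pow_succ] at h3
  omega

theorem sum_norm_sq_sparsePoint_le {ν : ℕ} (hν : 3 ≤ ν) (i : Fin ν) (u : Hilb ν)
    (s : Finset ℕ) : ∑ k ∈ s, ‖u (sparsePoint i k)‖ ^ 2 ≤ 12 * energy u := by
  have hG := hasSum_energy u
  set G : Lattice ν → ℝ := fun n => ∑ i, ‖u (n + unitVec i) - u n‖ ^ 2 with hGdef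
  have hG0 : ∀ n, 0 ≤ G n := fun n => Finset.sum_nonneg fun _ _ => by positivity
  have hE : ∀ p n, simplexEnergy (fun x => u (p + natPoint x)) n =
      ∑ x ∈ simplex ν n, G (p + natPoint x) := simplexEnergy_translate u
  -- The radius 2^k is small enough for disjointness of the near regions and large enough for the
  -- far terms to be summable over k.
  have hpt : ∀ k, ‖u (sparsePoint i k)‖ ^ 2 ≤
      4 * ∑ n ∈ Finset.range (2 ^ k), ∑ x ∈ simplex ν n, G (sparsePoint i k + natPoint x) +
        4 / ((2 : ℝ) ^ k + 1) * energy u := by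
    intro k
    have hinj : Function.Injective fun x : Fin ν → ℕ => sparsePoint i k + natPoint x :=
      (add_right_injective _).comp natPoint_injective
    have h := norm_apply_zero_sq_le hν (fun x => u (sparsePoint i k + natPoint x))
      ((hasSum_norm_sq u).summable.comp_injective hinj) (D := energy u) ?_ (2 ^ k)
    · simp only [hE, natPoint_zero, add_zero] at h
      exact_mod_cast h
    · intro t
      simp only [hE]
      rw [Finset.sum_sigma']
      refine sum_comp_le_of_hasSum hG hG0 _
        (fun q : (_ : ℕ) × (Fin ν → ℕ) => sparsePoint i k + natPoint q.2) ?_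
      rintro ⟨n, x⟩ hx ⟨m, y⟩ hy hxy
      obtain rfl : x = y := hinj hxy
      -- The level is the coordinate sum, so no vertex is counted at two levels.
      simp only [Finset.coe_sigma, Set.mem_sigma_iff, Finset.mem_coe, mem_simplex] at hx hy
      obtain rfl : n = m := hx.2.symm.trans hy.2
      rfl
  have hnear : ∑ k ∈ s, ∑ n ∈ Finset.range (2 ^ k), ∑ x ∈ simplex ν n,
      G (sparsePoint i k + natPoint x) ≤ energy u := by
    have h1 : ∀ k ∈ s, ∑ n ∈ Finset.range (2 ^ k), ∑ x ∈ simplex ν n,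
        G (sparsePoint i k + natPoint x) =
        ∑ q ∈ (Finset.range (2 ^ k)).sigma fun n => simplex ν n,
          G (sparsePoint i k + natPoint q.2) := fun k _ => Finset.sum_sigma' _ _ _
    rw [Finset.sum_congr rfl h1, Finset.sum_sigma']
    refine sum_comp_le_of_hasSum hG hG0 _
      (fun q : (_ : ℕ) × ((_ : ℕ) × (Fin ν → ℕ)) => sparsePoint i q.1 + natPoint q.2.2) ?_
    rintro ⟨k, n, x⟩ hx ⟨l, m, y⟩ hy hxy
    simp only [Finset.mem_coe, Finset.mem_sigma, Finset.mem_range] at hx hy hxy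
    have hkl : k = l := by
      rcases lt_trichotomy k l with h | h | h
      · exact absurd hxy
          (sparsePoint_add_natPoint_ne i h (lt_of_mem_simplex hx.2.2 hx.2.1 i))
      · exact h
      · exact absurd hxy.symm
          (sparsePoint_add_natPoint_ne i h (lt_of_mem_simplex hy.2.2 hy.2.1 i))
    subst hkl
    obtain rfl : x = y := natPoint_injective (add_left_cancel hxy)
    obtain rfl : n = m := (mem_simplex.mp hx.2.2).symm.trans (mem_simplex.mp hy.2.2)
    rfl
  have hen : 0 ≤ energy u := Finset.sum_nonneg fun _ _ => by positivity
  -- Far terms contribute 8 and near terms 4, whence the constant 12.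
  have hgeo : ∑ k ∈ s, 4 / ((2 : ℝ) ^ k + 1) ≤ 8 := by
    calc ∑ k ∈ s, 4 / ((2 : ℝ) ^ k + 1) ≤ ∑ k ∈ s, 4 * (1 / 2 : ℝ) ^ k := by
          refine Finset.sum_le_sum fun k _ => ?_
          rw [one_div, inv_pow, ← div_eq_mul_inv]
          gcongr
          linarith
      _ ≤ 4 * 2 := by
          rw [← Finset.mul_sum]
          gcongr
          exact sum_le_hasSum _ (fun _ _ => by positivity) hasSum_geometric_two
      _ = 8 := by norm_num
  calc _ ≤ ∑ k ∈ s, _ := Finset.sum_le_sum fun k _ => hpt k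
    _ ≤ 4 * energy u + 8 * energy u := by
        rw [Finset.sum_add_distrib, ← Finset.mul_sum, ← Finset.sum_mul]
        gcongr
    _ = _ := by ring

/-! ### The sparse potential and the upper inclusion of spectra -/

open Classical in
/-- The potential with value `1 / 12` at the sparse points and `0` elsewhere. -/
noncomputable def sparsePotential {ν : ℕ} (i : Fin ν) : Potential ν :=
  ⟨fun n => if n ∈ Set.range (sparsePoint i) then 1 / 12 else 0, memℓp_infty ⟨1 / 12, by
    rintro _ ⟨n, rfl⟩
    dsimp only
    split_ifs <;> norm_num⟩⟩

theorem sparsePotential_sparsePoint {ν : ℕ} (i : Fin ν) (k : ℕ) :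
    sparsePotential i (sparsePoint i k) = 1 / 12 :=
  if_pos ⟨k, rfl⟩

theorem sparsePotential_of_notMem {ν : ℕ} {i : Fin ν} {n : Lattice ν}
    (h : n ∉ Set.range (sparsePoint i)) : sparsePotential i n = 0 :=
  if_neg h

theorem sparsePotential_nonneg {ν : ℕ} (i : Fin ν) (n : Lattice ν) : 0 ≤ sparsePotential i n := by
  by_cases h : n ∈ Set.range (sparsePoint i)
  · obtain ⟨k, rfl⟩ := h
    rw [sparsePotential_sparsePoint]
    norm_num
  · rw [sparsePotential_of_notMem h]

theorem exists_eq_sparsePoint {ν : ℕ} {i : Fin ν} {n : Lattice ν} (h : sparsePotential i n ≠ 0) :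
    ∃ k, sparsePoint i k = n := by
  by_contra hn
  exact h (sparsePotential_of_notMem hn)

/-- The gap is at least 3 · 4^(l - 1) ≥ 3l, so a bounded gap leaves finitely many indices. -/
theorem lt_toNat_of_abs_four_pow_sub_le {k l : ℕ} {R : ℤ} (hkl : k < l)
    (h : |(4 : ℤ) ^ k - 4 ^ l| ≤ R) : l < R.toNat := by
  have h1 : 4 ^ (k + 1) ≤ 4 ^ l := Nat.pow_le_pow_right (by norm_num) hkl
  have h3 : (4 : ℕ) ^ l = 4 * 4 ^ (l - 1) := by
    rw [← pow_succ', Nat.sub_add_cancel (by omega)]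
  have h4 : l - 1 < 4 ^ (l - 1) := Nat.lt_pow_self (by norm_num)
  rw [pow_succ] at h1
  have h1' : (4 : ℤ) ^ k * 4 ≤ 4 ^ l := by exact_mod_cast h1
  have h3' : (4 : ℤ) ^ l = 4 * 4 ^ (l - 1) := by exact_mod_cast h3
  have h4' : ((l - 1 : ℕ) : ℤ) < 4 ^ (l - 1) := by exact_mod_cast h4
  have h5 := neg_abs_le ((4 : ℤ) ^ k - 4 ^ l)
  have h6 : (1 : ℤ) ≤ 4 ^ k := one_le_pow₀ (by norm_num)
  omega

theorem isSparse_sparsePotential {ν : ℕ} (i : Fin ν) : IsSparse (sparsePotential i) := by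
  intro R
  refine Set.Finite.subset (((Finset.range R.toNat ×ˢ Finset.range R.toNat).image
    fun q => (sparsePoint i q.1, sparsePoint i q.2)).finite_toSet) ?_
  rintro ⟨n, m⟩ ⟨hn, hm, hne, hR⟩
  obtain ⟨k, rfl⟩ := exists_eq_sparsePoint hn
  obtain ⟨l, rfl⟩ := exists_eq_sparsePoint hm
  dsimp only at hne hR
  rw [sparsePoint, sparsePoint, ← Pi.single_sub, len_single] at hR
  have hkl : k ≠ l := fun h => hne (h ▸ rfl)
  simp only [Finset.coe_image, Set.mem_image, Finset.mem_coe, Finset.mem_product, Finset.mem_range]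
  refine ⟨(k, l), ?_, rfl⟩
  rcases lt_or_gt_of_ne hkl with h | h
  · have := lt_toNat_of_abs_four_pow_sub_le h hR
    exact ⟨h.trans this, this⟩
  · rw [abs_sub_comm] at hR
    have := lt_toNat_of_abs_four_pow_sub_le h hR
    exact ⟨this, h.trans this⟩

theorem re_inner_sparsePotential_le {ν : ℕ} (hν : 3 ≤ ν) (i : Fin ν) (u : Hilb ν) :
    (inner ℂ (mulOp (sparsePotential i) u) u).re ≤ energy u := by
  have h := hasSum_mulOp (sparsePotential i) u
  rw [← (sparsePoint_injective i).hasSum_iff] at h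
  · refine hasSum_le_of_sum_le h fun s => ?_
    simp only [Function.comp_apply, sparsePotential_sparsePoint]
    rw [← Finset.mul_sum]
    linarith [sum_norm_sq_sparsePoint_le hν i u s]
  · intro n hn
    rw [sparsePotential_of_notMem hn, zero_mul]

theorem spectrum_sparse_subset {ν : ℕ} (hν : 3 ≤ ν) (i : Fin ν) :
    spectrum ℂ (schrodingerOp (sparsePotential i)) ⊆ freeBand ν := by
  have hform : ∀ u : Hilb ν, (inner ℂ (schrodingerOp (sparsePotential i) u) u).re =
      (inner ℂ (freeOp ν u) u).re + (inner ℂ (mulOp (sparsePotential i) u) u).re := by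
    intro u
    rw [schrodingerOp, add_apply, inner_add_left, Complex.add_re]
  refine spectrum_subset_of_form_bounds (isSelfAdjoint_schrodingerOp _) (fun u => ?_) fun u => ?_
  · have h1 := (hasSum_mulOp (sparsePotential i) u).nonneg fun n =>
      mul_nonneg (sparsePotential_nonneg i n) (sq_nonneg _)
    rw [hform]
    linarith [neg_le_re_inner_freeOp u]
  · rw [hform]
    linarith [re_inner_sparsePotential_le hν i u, energy_eq u]

theorem frequently_sparsePotential {ν : ℕ} (i : Fin ν) :
    ∃ᶠ n in atInfty ν, 1 / 12 ≤ |sparsePotential i n| := by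
  rw [atInfty_eq_cofinite, frequently_cofinite_iff_infinite]
  refine (Set.infinite_range_of_injective (sparsePoint_injective i)).mono ?_
  rintro _ ⟨k, rfl⟩
  rw [Set.mem_ofPred_eq, sparsePotential_sparsePoint]
  norm_num

theorem limsup_sparsePotential_pos {ν : ℕ} (i : Fin ν) :
    0 < limsup (fun n => |sparsePotential i n|) (atInfty ν) := by
  refine lt_of_lt_of_le (by norm_num : (0 : ℝ) < 1 / 12)
    (le_limsup_of_frequently_le (frequently_sparsePotential i) ?_)
  exact isBoundedUnder_of ⟨‖sparsePotential i‖, fun n =>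
    lp.norm_apply_le_norm (by simp) (sparsePotential i) n⟩

theorem not_tendsto_sparsePotential {ν : ℕ} (i : Fin ν) :
    ¬ Tendsto (fun n => sparsePotential i n) (atInfty ν) (𝓝 0) := by
  intro h
  have h1 := h.abs
  rw [abs_zero] at h1
  have h2 := h1.eventually_lt_const (by norm_num : (0 : ℝ) < 1 / 12)
  obtain ⟨n, hn, hn'⟩ := ((frequently_sparsePotential i).and_eventually h2).exists
  linarith

/-! ### Approximate eigenvectors and the lower inclusion of spectra -/

/-- Weyl's criterion: approximate eigenvalues belong to the spectrum. -/
theorem mem_spectrum_of_approx_eigenvector {H : Type*} [NormedAddCommGroup H] [NormedSpace ℂ H]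
    (T : H →L[ℂ] H) (z : ℂ) (h : ∀ ε > 0, ∃ u, u ≠ 0 ∧ ‖T u - z • u‖ ≤ ε * ‖u‖) :
    z ∈ spectrum ℂ T := by
  intro hz
  obtain ⟨S, hS⟩ := hz.exists_left_inv
  obtain ⟨u, hu, hle⟩ := h (1 / (2 * (‖S‖ + 1))) (by positivity)
  have h1 : S (z • u - T u) = u := by
    have := congrArg (fun A : H →L[ℂ] H => A u) hS
    simpa [Algebra.algebraMap_eq_smul_one] using this
  have h2 : ‖u‖ ≤ ‖S‖ * ‖T u - z • u‖ := by
    rw [norm_sub_rev]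
    simpa [h1] using S.le_opNorm (z • u - T u)
  have h3 := norm_pos_iff.mpr hu
  have h4 : ‖S‖ * ‖T u - z • u‖ ≤ (‖S‖ + 1) * (1 / (2 * (‖S‖ + 1)) * ‖u‖) := by
    gcongr
    linarith
  have h5 : (‖S‖ + 1) * (1 / (2 * (‖S‖ + 1)) * ‖u‖) = ‖u‖ / 2 := by
    have : ‖S‖ + 1 ≠ 0 := by positivity
    field_simp
  linarith

/-- The box `[1, N]^ν`. -/
noncomputable def box (ν N : ℕ) : Finset (Lattice ν) := Fintype.piFinset fun _ => Finset.Icc 1 (N : ℤ)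

theorem mem_box {ν N : ℕ} {n : Lattice ν} : n ∈ box ν N ↔ ∀ i, 1 ≤ n i ∧ n i ≤ N := by
  simp [box]

theorem card_box (ν N : ℕ) : (box ν N).card = N ^ ν := by
  simp [box]

/-- The plane wave with all quasi-momenta equal, cut off to a box. -/
noncomputable def boxWave (ν N : ℕ) (z : ℂ) : Hilb ν :=
  ⟨fun n => if n ∈ box ν N then z ^ (∑ i, n i) else 0, memℓp_gen
    (summable_of_ne_finset_zero (s := box ν N) fun n hn => by simp [hn])⟩

theorem boxWave_apply {ν N : ℕ} (z : ℂ) (n : Lattice ν) :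
    boxWave ν N z n = if n ∈ box ν N then z ^ (∑ i, n i) else 0 := rfl

theorem norm_boxWave_sq {ν N : ℕ} {z : ℂ} (hz : ‖z‖ = 1) : ‖boxWave ν N z‖ ^ 2 = N ^ ν := by
  have h : HasSum (fun n => ‖boxWave ν N z n‖ ^ 2) (∑ n ∈ box ν N, ‖boxWave ν N z n‖ ^ 2) :=
    hasSum_sum_of_ne_finset_zero fun n hn => by simp [boxWave_apply, hn]
  rw [(hasSum_norm_sq _).unique h, ← Nat.cast_pow, ← card_box, Finset.card_eq_sum_ones,
    Nat.cast_sum]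
  refine Finset.sum_congr rfl fun n hn => ?_
  simp [boxWave_apply, hn, hz]

/-- The faces of the box orthogonal to a coordinate direction. -/
noncomputable def boxFaces {ν : ℕ} (N : ℕ) (i : Fin ν) : Finset (Lattice ν) :=
  Fintype.piFinset fun j => if j = i then {0, (N : ℤ)} else Finset.Icc 1 (N : ℤ)

theorem card_boxFaces_le {ν : ℕ} (N : ℕ) (i : Fin ν) :
    (boxFaces N i).card ≤ 2 * N ^ (ν - 1) := by
  rw [boxFaces, Fintype.card_piFinset, ← Finset.mul_prod_erase _ _ (Finset.mem_univ i), if_pos rfl]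
  refine Nat.mul_le_mul Finset.card_le_two (le_of_eq ?_)
  rw [Finset.prod_congr rfl (g := fun _ => N)]
  · simp
  · intro j hj
    simp [Finset.ne_of_mem_erase hj]

/-- A unit step in direction i enters the box from coordinate 0 or leaves it from coordinate N,
which explains the two values in `boxFaces`. -/
theorem mem_boxFaces_of_mem_of_notMem {ν N : ℕ} {i : Fin ν} {n : Lattice ν}
    (h : ¬ (n + unitVec i ∈ box ν N ↔ n ∈ box ν N)) : n ∈ boxFaces N i := by
  have hoff : ∀ j, j ≠ i → (n + unitVec i) j = n j := fun j hj => by simp [hj]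
  have hon : (n + unitVec i) i = n i + 1 := by simp
  have hsplit : ∀ m : Lattice ν, m ∈ box ν N ↔
      (1 ≤ m i ∧ m i ≤ N) ∧ ∀ j, j ≠ i → 1 ≤ m j ∧ m j ≤ N := by
    intro m
    rw [mem_box]
    refine ⟨fun h => ⟨h i, fun j _ => h j⟩, fun h j => ?_⟩
    by_cases hj : j = i
    · exact hj ▸ h.1
    · exact h.2 j hj
  have hrest : (∀ j, j ≠ i → 1 ≤ (n + unitVec i) j ∧ (n + unitVec i) j ≤ N) ↔
      ∀ j, j ≠ i → 1 ≤ n j ∧ n j ≤ N := by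
    refine forall_congr' fun j => forall_congr' fun hj => ?_
    rw [hoff j hj]
  rw [hsplit, hsplit, hrest, hon] at h
  rw [boxFaces, Fintype.mem_piFinset]
  intro j
  by_cases hj : j = i
  · subst hj
    rw [if_pos rfl, Finset.mem_insert, Finset.mem_singleton]
    by_contra hc
    refine h (and_congr_left fun _ => ?_)
    omega
  · rw [if_neg hj, Finset.mem_Icc]
    by_contra hc
    exact h ⟨fun hn => absurd (hn.2 j hj) hc, fun hn => absurd (hn.2 j hj) hc⟩

/-- The full plane wave is an exact eigenvector of the shift, so truncation errs only on the two
faces, by modulus at most 1. -/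
theorem norm_shift_boxWave_sub_sq_le {ν N : ℕ} {z : ℂ} (hz : ‖z‖ = 1) (i : Fin ν) :
    ‖shift (unitVec i) (boxWave ν N z) - z • boxWave ν N z‖ ^ 2 ≤ 2 * N ^ (ν - 1) := by
  have hz0 : z ≠ 0 := by
    rintro rfl
    simp at hz
  set d := shift (unitVec i) (boxWave ν N z) - z • boxWave ν N z with hd
  have hdn : ∀ n, d n = boxWave ν N z (n + unitVec i) - z * boxWave ν N z n := fun n => rfl
  have hle : ∀ n, ‖d n‖ ^ 2 ≤ if n ∈ boxFaces N i then 1 else 0 := by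
    intro n
    have hs : ∑ j, (n + unitVec i : Lattice ν) j = ∑ j, n j + 1 := by
      simp [Finset.sum_add_distrib, Pi.single_apply]
    rw [hdn, boxWave_apply, boxWave_apply, hs]
    by_cases hf : n ∈ boxFaces N i
    · rw [if_pos hf]
      by_cases h1 : n + unitVec i ∈ box ν N <;> by_cases h2 : n ∈ box ν N
      · simp [h1, h2, zpow_add_one₀ hz0, mul_comm]
      · simp [h1, h2, hz]
      · simp [h1, h2, hz]
      · simp [h1, h2]
    · have hiff := not_not.mp (mt mem_boxFaces_of_mem_of_notMem hf)
      rw [if_neg hf]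
      by_cases h2 : n ∈ box ν N
      · simp [hiff.mpr h2, h2, zpow_add_one₀ hz0, mul_comm]
      · simp [mt hiff.mp h2, h2]
  have h1 : HasSum (fun n => if n ∈ boxFaces N i then (1 : ℝ) else 0)
      (∑ n ∈ boxFaces N i, if n ∈ boxFaces N i then (1 : ℝ) else 0) :=
    hasSum_sum_of_ne_finset_zero fun n hn => by simp [hn]
  refine (hasSum_le hle (hasSum_norm_sq d) h1).trans ?_
  rw [Finset.sum_congr rfl fun n hn => if_pos hn, ← Nat.cast_one, ← Nat.cast_sum,
    ← Finset.card_eq_sum_ones]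
  exact_mod_cast card_boxFaces_le N i

/-- The two shifts are mutually inverse isometries and |z| = 1, so backward steps need no separate
estimate. -/
theorem norm_shift_neg_sub {ν : ℕ} {z : ℂ} (hz : ‖z‖ = 1) (j : Lattice ν) (u : Hilb ν) :
    ‖shift (-j) u - z⁻¹ • u‖ = ‖shift j u - z • u‖ := by
  have hz0 : z ≠ 0 := by
    rintro rfl
    simp at hz
  rw [← (shift j).norm_map, map_sub, map_smul, shift_shift_neg]
  have h : shift j u - z • u = (-z) • (u - z⁻¹ • shift j u) := by
    rw [smul_sub, smul_smul]
    simp [hz0, add_comm, sub_eq_add_neg]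
  rw [h, norm_smul, norm_neg, hz, one_mul]

theorem norm_freeOp_boxWave_sub_le {ν N : ℕ} {z : ℂ} (hz : ‖z‖ = 1) :
    ‖freeOp ν (boxWave ν N z) - (ν * (z + z⁻¹)) • boxWave ν N z‖ ≤
      2 * ν * √(2 * N ^ (ν - 1)) := by
  have h : freeOp ν (boxWave ν N z) - (ν * (z + z⁻¹)) • boxWave ν N z =
      ∑ i, ((shift (unitVec i) (boxWave ν N z) - z • boxWave ν N z) +
        (shift (-unitVec i) (boxWave ν N z) - z⁻¹ • boxWave ν N z)) := by
    rw [freeOp_eq]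
    simp only [Finset.sum_add_distrib, Finset.sum_sub_distrib, Finset.sum_const, Finset.card_univ,
      Fintype.card_fin, mul_smul, add_smul, smul_add, Nat.cast_smul_eq_nsmul]
    abel
  rw [h]
  calc _ ≤ ∑ _i : Fin ν, 2 * √(2 * N ^ (ν - 1)) := by
        refine norm_sum_le_of_le _ fun i _ => (norm_add_le _ _).trans ?_
        rw [norm_shift_neg_sub hz, two_mul]
        have := Real.le_sqrt_of_sq_le (norm_shift_boxWave_sub_sq_le (N := N) hz i)
        gcongr
    _ = _ := by
        simp
        ring

/-- A potential vanishing on the open positive orthant does not remove any free spectrum. -/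
theorem freeBand_subset_spectrum {ν : ℕ} (hν : 0 < ν) {V : Potential ν}
    (hV : ∀ n, (∀ i, 1 ≤ n i) → V n = 0) : freeBand ν ⊆ spectrum ℂ (schrodingerOp V) := by
  rintro _ ⟨t, ⟨ht1, ht2⟩, rfl⟩
  have hνR : (0 : ℝ) < ν := by exact_mod_cast hν
  -- Chosen so that the plane wave has energy ν(z + z⁻¹) = 2ν cos θ = t.
  set θ := Real.arccos (t / (2 * ν)) with hθ
  have hcos : Real.cos θ = t / (2 * ν) := by
    apply Real.cos_arccos
    · rw [le_div_iff₀ (by positivity)]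
      linarith
    · rw [div_le_one (by positivity)]
      exact ht2
  set z : ℂ := Complex.exp (θ * Complex.I) with hzdef
  have hz : ‖z‖ = 1 := Complex.norm_exp_ofReal_mul_I θ
  have hzt : (ν : ℂ) * (z + z⁻¹) = (t : ℂ) := by
    have h1 : z + z⁻¹ = 2 * Complex.cos θ := by
      rw [hzdef, ← Complex.exp_neg, Complex.two_cos, neg_mul]
    rw [h1, ← Complex.ofReal_cos, hcos]
    have : (ν : ℂ) ≠ 0 := by exact_mod_cast hν.ne'
    push_cast
    field_simp
  refine mem_spectrum_of_approx_eigenvector _ _ fun ε hε => ?_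
  -- The squared error is at most (2ν)² · 2N^(ν - 1), against ε² N^ν; the bound 1 keeps N positive.
  obtain ⟨N, hN⟩ := exists_nat_gt (max 1 ((2 * ν) ^ 2 * 2 / ε ^ 2 : ℝ))
  have hN1 : (1 : ℝ) < N := (le_max_left _ _).trans_lt hN
  have hN2 : ((2 * ν) ^ 2 * 2 / ε ^ 2 : ℝ) < N := (le_max_right _ _).trans_lt hN
  rw [div_lt_iff₀ (by positivity)] at hN2
  have hnorm := norm_boxWave_sq (ν := ν) (N := N) hz
  have hNpos : (0 : ℝ) < N := by linarith
  refine ⟨boxWave ν N z, ?_, ?_⟩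
  · intro h0
    rw [h0, norm_zero, zero_pow two_ne_zero] at hnorm
    exact (pow_pos hNpos ν).ne hnorm
  · have hVu : mulOp V (boxWave ν N z) = 0 := by
      ext n
      rw [mulOp_apply, boxWave_apply]
      split_ifs with hn
      · rw [hV n fun i => (mem_box.mp hn i).1]
        simp
      · simp
    rw [schrodingerOp, add_apply, hVu, add_zero, ← hzt]
    refine (norm_freeOp_boxWave_sub_le hz).trans ?_
    refine le_of_sq_le_sq ?_ (by positivity)
    rw [mul_pow, mul_pow ε, hnorm, Real.sq_sqrt (by positivity)]
    have hpow : (N : ℝ) ^ ν = N * N ^ (ν - 1) := by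
      rw [← pow_succ', Nat.sub_add_cancel hν]
    rw [hpow]
    have := mul_le_mul_of_nonneg_right hN2.le (by positivity : (0 : ℝ) ≤ N ^ (ν - 1))
    linarith

end DiscreteSchrodinger

theorem theorem4p2 (ν : ℕ) (hν : 3 ≤ ν) :
    (∃ V : DiscreteSchrodinger.Potential ν,
      (∀ n, 0 ≤ V n) ∧
      DiscreteSchrodinger.IsSparse V ∧
      spectrum ℂ (DiscreteSchrodinger.schrodingerOp V) = DiscreteSchrodinger.freeBand ν ∧
      0 < limsup (fun n => |V n|) (DiscreteSchrodinger.atInfty ν)) ∧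
    ¬ (∀ V : DiscreteSchrodinger.Potential ν,
      DiscreteSchrodinger.essSpectrum (DiscreteSchrodinger.schrodingerOp V)
        ⊆ DiscreteSchrodinger.freeBand ν →
      Tendsto (fun n => V n) (DiscreteSchrodinger.atInfty ν) (𝓝 0)) := by
  have i : Fin ν := ⟨0, by omega⟩
  have hspec : spectrum ℂ (DiscreteSchrodinger.schrodingerOp
      (DiscreteSchrodinger.sparsePotential i)) = DiscreteSchrodinger.freeBand ν := by
    refine (DiscreteSchrodinger.spectrum_sparse_subset hν i).antisymm
      (DiscreteSchrodinger.freeBand_subset_spectrum (by omega) fun n hn => ?_)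
    refine DiscreteSchrodinger.sparsePotential_of_notMem ?_
    rintro ⟨k, rfl⟩
    -- Sparse points lie on one axis, so any other coordinate is 0 and keeps them off the open
    -- orthant.
    obtain ⟨j, hj⟩ : ∃ j : Fin ν, j ≠ i := by
      have : Nontrivial (Fin ν) := Fin.nontrivial_iff_two_le.mpr (by omega)
      exact exists_ne i
    have := hn j
    simp [DiscreteSchrodinger.sparsePoint, hj] at this
  refine ⟨⟨DiscreteSchrodinger.sparsePotential i, DiscreteSchrodinger.sparsePotential_nonneg i,
    DiscreteSchrodinger.isSparse_sparsePotential i, hspec,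
    DiscreteSchrodinger.limsup_sparsePotential_pos i⟩, fun h => ?_⟩
  exact DiscreteSchrodinger.not_tendsto_sparsePotential i
    (h _ fun z hz => hspec ▸ hz.1)
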